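/- Let $k$ be an infinite field, $S=k[x,y,z]$, and let $\mathcal A$ be a finite set of points of $\mathbf P^2=\mathbf P^2(k)$. Let $I_{\mathcal A}\subseteq S$ be the vanishing ideal of the union of the one-dimensional subspaces of $k^3$ corresponding to the points of $\mathcal A$. An ideal of $S$ is called pl-generated if it is generated by products of linear forms (the empty product $1$ being allowed). (1) If $\mathcal A$ is contained in a union of two lines, then $I_{\mathcal A}$ is pl-generated. (2) Let $L_1,L_2$ be nonzero linear forms defining two distinct lines whose union contains $\mathcal A$ and whose intersection point is not in $\mathcal A$. Let $p_1,\dots,p_{r_1}$ be the distinct points of $\mathcal A$ on the line $L_1=0$ and $q_1,\dots,q_{r_2}$ the distinct points of $\mathcal A$ on the line $L_2=0$, and suppose $r_1\ge r_2$. Then one can choose linear forms $h_1,\dots,h_{r_1}$ such that, for $i\le r_2$, $h_i$ defines the line joining $p_i$ to $q_i$, and, for $r_2<i\le r_1$, $h_i$ defines a line through $p_i$ different from the line $L_1=0$. For every such choice, $$I_{\mathcal A}=\bigl(L_1L_2,\; L_1h_1\cdots h_{r_2},\; h_1\cdots h_{r_1}\bigr),$$ and if $r_1=r_2$, then $I_{\mathcal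 A}=(L_1L_2,\;h_1\cdots h_{r_1})$. -/

import Mathlib

namespace PLGen

open MvPolynomial

/-- The projective plane over `k`: its points are the one-dimensional subspaces of `k³`. -/
abbrev Plane (k : Type*) [Field k] : Type _ := Projectivization k (Fin 3 → k)

/-- The cone `V_A ⊆ k³` of a set `A` of points: the union of the one-dimensional subspaces
that are the points of `A`. -/
def cone {k : Type*} [Field k] (A : Set (Plane k)) : Set (Fin 3 → k) :=
  ⋃ p ∈ A, (p.submodule : Set (Fin 3 → k))

/-- The ideal `I_A` of all polynomials in `k[x, y, z]` that vanish on the cone of `A`. -/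
noncomputable def idealOf {k : Type*} [Field k] (A : Set (Plane k)) :
    Ideal (MvPolynomial (Fin 3) k) :=
  vanishingIdeal k (cone A)

/-- The points of the plane at which the form `f` vanishes. -/
def zeros {k : Type*} [Field k] (f : MvPolynomial (Fin 3) k) : Set (Plane k) :=
  {p | ∀ v ∈ p.submodule, eval v f = 0}

/-- `f` is a nonzero linear form, that is, an equation of a line. -/
def IsLineEq {k : Type*} [Field k] (f : MvPolynomial (Fin 3) k) : Prop :=
  f.IsHomogeneous 1 ∧ f ≠ 0

/-- A line of the projective plane. -/
def IsLine {k : Type*} [Field k] (L : Set (Plane k)) : Prop :=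
  ∃ f : MvPolynomial (Fin 3) k, IsLineEq f ∧ L = zeros f

/-- `g` is a product of finitely many linear forms (the empty product is `1`). -/
def IsProdLinear {k : Type*} [Field k] (g : MvPolynomial (Fin 3) k) : Prop :=
  ∃ s : Multiset (MvPolynomial (Fin 3) k), (∀ f ∈ s, f.IsHomogeneous 1) ∧ g = s.prod

/-- An ideal is pl-generated if it is generated by products of linear forms. -/
def IsPLGenerated {k : Type*} [Field k] (I : Ideal (MvPolynomial (Fin 3) k)) : Prop :=
  ∃ G : Set (MvPolynomial (Fin 3) k), (∀ g ∈ G, IsProdLinear g) ∧ I = Ideal.span G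

/-- Given points `p_1, …, p_{r₁}` on the line `ℓ₁ = 0` and points `q_1, …, q_{r₂}`, `r₂ ≤ r₁`:
for `i ≤ r₂` the form `h_i` is an equation of the line joining `p_i` to `q_i`, and for `i > r₂`
it is an equation of a line through `p_i` other than `ℓ₁ = 0`. -/
structure IsJoinFamily {k : Type*} [Field k] (ℓ₁ : MvPolynomial (Fin 3) k) {r₁ r₂ : ℕ}
    (hr : r₂ ≤ r₁) (p : Fin r₁ → Plane k) (q : Fin r₂ → Plane k)
    (h : Fin r₁ → MvPolynomial (Fin 3) k) : Prop where
  isLineEq : ∀ i, IsLineEq (h i)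
  mem_left : ∀ i, p i ∈ zeros (h i)
  mem_right : ∀ i : Fin r₂, q i ∈ zeros (h (Fin.castLE hr i))
  ne_line : ∀ i : Fin r₁, r₂ ≤ (i : ℕ) → zeros (h i) ≠ zeros ℓ₁

end PLGen

namespace PLGen

open MvPolynomial

/-! The engine is `exists_eq_of_forall_mem_zeros`: a polynomial vanishing at finitely many points of
the line f = 0 has the form a f + b ∏ hᵢ, where hᵢ is any other line through the i-th point. It is
applied twice. The points on ℓ₁ give u = a ℓ₁ + b ∏ hᵢ. The joining lines make ∏ hᵢ vanish at the
points qⱼ too, where ℓ₁ does not vanish, so a vanishes at every qⱼ; hence a = c ℓ₂ + d ∏ hⱼ over j ≤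
r₂, and substitution gives the three generators. If the intersection point x lies in A, ℓ₂ itself
serves as the line through x, and the same division works with arbitrary lines through the other
points. -/

variable {k : Type*} [Field k]

/-! ### Linear forms and linear algebra in k³ -/

/-- The linear form with coefficient vector `a`. -/
noncomputable def linearForm (a : Fin 3 → k) : MvPolynomial (Fin 3) k :=
  ∑ i, C (a i) * X i

theorem eval_linearForm (a v : Fin 3 → k) : eval v (linearForm a) = a ⬝ᵥ v := by
  simp [linearForm, dotProduct]

theorem isHomogeneous_linearForm (a : Fin 3 → k) : (linearForm a).IsHomogeneous 1 :=
  IsHomogeneous.sum _ _ _ fun i _ => isHomogeneous_C_mul_X (a i) i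

theorem linearForm_add (a b : Fin 3 → k) :
    linearForm (a + b) = linearForm a + linearForm b := by
  simp [linearForm, add_mul, Finset.sum_add_distrib]

theorem linearForm_smul (c : k) (a : Fin 3 → k) :
    linearForm (c • a) = C c * linearForm a := by
  simp [linearForm, Finset.mul_sum, mul_assoc]

theorem linearForm_single (i : Fin 3) : linearForm (Pi.single i (1 : k)) = X i := by
  simp [linearForm, Pi.single_apply, apply_ite C, ite_mul]

theorem exists_eq_linearForm {f : MvPolynomial (Fin 3) k} (hf : f.IsHomogeneous 1) :
    ∃ a, f = linearForm a := by
  refine ⟨fun i => coeff (Finsupp.single i 1) f, ?_⟩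
  ext d
  by_cases hd : d.degree = 1
  · obtain ⟨i, rfl⟩ := (Finsupp.sum_eq_one_iff d).1 hd
    simp [linearForm, coeff_sum, coeff_C_mul, coeff_X, Finsupp.single_left_inj]
  · rw [hf.coeff_eq_zero hd, (isHomogeneous_linearForm _).coeff_eq_zero hd]

theorem linearForm_ne_zero {a : Fin 3 → k} (ha : a ≠ 0) : linearForm a ≠ 0 := by
  obtain ⟨i, hi⟩ := Function.ne_iff.1 ha
  intro h
  apply hi
  simpa [h] using (eval_linearForm a (Pi.single i 1)).symm

/-- Three vectors orthogonal to a common nonzero vector: the third is a combination of the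
first two as soon as these are not proportional. -/
theorem exists_combination {a b c v : Fin 3 → k} (hv : v ≠ 0) (ha : a ⬝ᵥ v = 0)
    (hb : b ⬝ᵥ v = 0) (hc : c ⬝ᵥ v = 0) (hab : LinearIndependent k ![a, b]) :
    ∃ s t : k, c = s • a + t • b := by
  have hdet : (Matrix.of ![a, b, c]).det = 0 := by
    refine Matrix.exists_mulVec_eq_zero_iff.1 ⟨v, hv, ?_⟩
    ext i
    fin_cases i <;> simpa [Matrix.mulVec]
  -- A left kernel vector is a linear relation among the rows; independence of `a`, `b` forces its
  -- last coefficient to be nonzero.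
  obtain ⟨w, hw, hw0⟩ := Matrix.exists_vecMul_eq_zero_iff.2 hdet
  have hsum : w 0 • a + w 1 • b + w 2 • c = 0 := by
    ext j
    simpa [Matrix.vecMul, dotProduct, Fin.sum_univ_three] using congrFun hw0 j
  have hw2 : w 2 ≠ 0 := by
    intro h2
    rw [h2, zero_smul, add_zero] at hsum
    obtain ⟨h0, h1⟩ := LinearIndependent.pair_iff.1 hab _ _ hsum
    apply hw
    ext i
    fin_cases i <;> assumption
  refine ⟨-(w 0 / w 2), -(w 1 / w 2), ?_⟩
  ext j
  have hj := congrFun hsum j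
  simp only [Pi.add_apply, Pi.smul_apply, smul_eq_mul, Pi.zero_apply] at hj ⊢
  field_simp
  linear_combination hj

/-- Any two vectors of `k³` are orthogonal to a common nonzero vector. -/
theorem exists_orthogonal_pair (u v : Fin 3 → k) :
    ∃ a : Fin 3 → k, a ≠ 0 ∧ a ⬝ᵥ u = 0 ∧ a ⬝ᵥ v = 0 := by
  have hdet : (Matrix.of ![u, v, 0]).det = 0 := Matrix.det_eq_zero_of_row_eq_zero 2 (by simp)
  obtain ⟨a, ha, h⟩ := Matrix.exists_mulVec_eq_zero_iff.2 hdet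
  refine ⟨a, ha, ?_, ?_⟩
  · simpa [Matrix.mulVec, dotProduct_comm] using congrFun h 0
  · simpa [Matrix.mulVec, dotProduct_comm] using congrFun h 1

/-! ### Vanishing at a projective point -/

/-- The restriction of polynomials to the line spanned by `v`. -/
noncomputable def restrictLine (v : Fin 3 → k) : MvPolynomial (Fin 3) k →ₐ[k] Polynomial k :=
  aeval fun i => Polynomial.C (v i) * Polynomial.X

theorem eval_restrictLine (v : Fin 3 → k) (t : k) (f : MvPolynomial (Fin 3) k) :
    (restrictLine v f).eval t = eval (t • v) f := by
  have : (Polynomial.aeval t).comp (restrictLine v) = (aeval (t • v) : _ →ₐ[k] k) := by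
    ext i
    simp [restrictLine, mul_comm t]
  have := DFunLike.congr_fun this f
  simpa [Polynomial.coe_aeval_eq_eval, coe_aeval_eq_eval] using this

theorem mem_zeros_iff_forall_smul {p : Plane k} {f : MvPolynomial (Fin 3) k} :
    p ∈ zeros f ↔ ∀ t : k, eval (t • p.rep) f = 0 := by
  simp [zeros, Projectivization.submodule_eq, Submodule.mem_span_singleton]

/-- Over an infinite field a univariate polynomial with only zero values is zero. As k[t] is a
domain, a product then vanishes at a point only if a factor does, even for inhomogeneous
polynomials. -/
theorem mem_zeros_iff_restrictLine [Infinite k] {p : Plane k} {f : MvPolynomial (Fin 3) k} :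
    p ∈ zeros f ↔ restrictLine p.rep f = 0 := by
  rw [mem_zeros_iff_forall_smul]
  refine ⟨fun h => Polynomial.funext fun t => ?_, fun h t => ?_⟩
  · rw [eval_restrictLine, h, Polynomial.eval_zero]
  · rw [← eval_restrictLine, h, Polynomial.eval_zero]

theorem mem_zeros_linearForm {p : Plane k} {a : Fin 3 → k} :
    p ∈ zeros (linearForm a) ↔ a ⬝ᵥ p.rep = 0 := by
  simp only [mem_zeros_iff_forall_smul, eval_linearForm, dotProduct_smul, smul_eq_mul]
  exact ⟨fun h => by simpa using h 1, fun h t => by rw [h, mul_zero]⟩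

theorem mem_zeros_mul [Infinite k] {p : Plane k} {f g : MvPolynomial (Fin 3) k} :
    p ∈ zeros (f * g) ↔ p ∈ zeros f ∨ p ∈ zeros g := by
  simp only [mem_zeros_iff_restrictLine, map_mul, mul_eq_zero]

theorem mem_zeros_prod [Infinite k] {ι : Type*} {s : Finset ι} {p : Plane k}
    {f : ι → MvPolynomial (Fin 3) k} :
    p ∈ zeros (∏ i ∈ s, f i) ↔ ∃ i ∈ s, p ∈ zeros (f i) := by
  simp only [mem_zeros_iff_restrictLine, map_prod, Finset.prod_eq_zero_iff]

theorem mem_zeros_of_add_left {p : Plane k} {f g : MvPolynomial (Fin 3) k}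
    (h : p ∈ zeros (f + g)) (hg : p ∈ zeros g) : p ∈ zeros f := fun v hv => by
  simpa [hg v hv] using h v hv

theorem mem_idealOf {A : Set (Plane k)} {f : MvPolynomial (Fin 3) k} :
    f ∈ idealOf A ↔ A ⊆ zeros f := by
  simp only [idealOf, cone, mem_vanishingIdeal_iff, Set.mem_iUnion]
  exact ⟨fun h p hp v hv => h v ⟨p, hp, hv⟩, fun h v ⟨p, hp, hv⟩ => h hp v hv⟩

/-! ### Two lines through a point, and collinear points -/

/-- Equations of distinct lines are linearly independent. -/
theorem linearIndependent_of_zeros_ne {a b : Fin 3 → k} (ha : a ≠ 0) (hb : b ≠ 0)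
    (h : zeros (linearForm a) ≠ zeros (linearForm b)) : LinearIndependent k ![a, b] := by
  rw [LinearIndependent.pair_iff' ha]
  rintro c rfl
  have hc : c ≠ 0 := by
    rintro rfl
    simp at hb
  apply h
  ext p
  simp [mem_zeros_linearForm, hc]

/-- Two distinct lines meet in at most one point. -/
theorem eq_of_mem_zeros {f g : MvPolynomial (Fin 3) k} (hf : IsLineEq f) (hg : IsLineEq g)
    (hfg : zeros f ≠ zeros g) {p q : Plane k} (hpf : p ∈ zeros f) (hpg : p ∈ zeros g)
    (hqf : q ∈ zeros f) (hqg : q ∈ zeros g) : p = q := by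
  obtain ⟨a, rfl⟩ := exists_eq_linearForm hf.1
  obtain ⟨b, rfl⟩ := exists_eq_linearForm hg.1
  have ha : a ≠ 0 := by
    rintro rfl
    exact hf.2 (by simp [linearForm])
  have hb : b ≠ 0 := by
    rintro rfl
    exact hg.2 (by simp [linearForm])
  have hab := linearIndependent_of_zeros_ne ha hb hfg
  rw [mem_zeros_linearForm] at hpf hpg hqf hqg
  obtain ⟨i, hi⟩ := Function.ne_iff.1 p.rep_nonzero
  have hi' : p.rep i ≠ 0 := hi
  rw [← p.mk_rep, ← q.mk_rep, eq_comm, Projectivization.mk_eq_mk_iff']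
  refine ⟨q.rep i / p.rep i, funext fun j => ?_⟩
  -- The vector pᵢeⱼ - pⱼeᵢ is orthogonal to p, so it is a combination of the two equations, hence
  -- also orthogonal to q: pᵢqⱼ = pⱼqᵢ.
  obtain ⟨s, t, hst⟩ := exists_combination
    (c := p.rep i • Pi.single j 1 - p.rep j • Pi.single i 1) p.rep_nonzero hpf hpg
    (by simp [sub_dotProduct, mul_comm]) hab
  have := congrArg (· ⬝ᵥ q.rep) hst
  simp only [sub_dotProduct, add_dotProduct, smul_dotProduct, hqf, hqg, single_dotProduct,
    smul_eq_mul, one_mul, mul_zero, add_zero] at this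
  simp only [Pi.smul_apply, smul_eq_mul]
  field_simp
  linear_combination -this

/-- The ideal of a point is generated by the equations of two distinct lines through it. -/
theorem exists_eq_of_mem_zeros [Infinite k] {f g u : MvPolynomial (Fin 3) k} (hf : IsLineEq f)
    (hg : IsLineEq g) (hfg : zeros f ≠ zeros g) {p : Plane k} (hpf : p ∈ zeros f)
    (hpg : p ∈ zeros g) (hu : p ∈ zeros u) : ∃ a b, u = a * f + b * g := by
  obtain ⟨a, rfl⟩ := exists_eq_linearForm hf.1
  obtain ⟨b, rfl⟩ := exists_eq_linearForm hg.1
  have ha : a ≠ 0 := by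
    rintro rfl
    exact hf.2 (by simp [linearForm])
  have hb : b ≠ 0 := by
    rintro rfl
    exact hg.2 (by simp [linearForm])
  have hab := linearIndependent_of_zeros_ne ha hb hfg
  rw [mem_zeros_linearForm] at hpf hpg
  rw [mem_zeros_iff_restrictLine] at hu
  set I : Ideal (MvPolynomial (Fin 3) k) := Ideal.span {linearForm a, linearForm b} with hI
  suffices h : u ∈ I by
    obtain ⟨x, y, hxy⟩ := Ideal.mem_span_pair.1 h
    exact ⟨x, y, hxy.symm⟩
  obtain ⟨i, hi⟩ := Function.ne_iff.1 p.rep_nonzero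
  have hi' : p.rep i ≠ 0 := hi
  -- modulo `I`, every variable is a multiple of `X i`
  have hX : ∀ j, Ideal.Quotient.mkₐ k I (X j) =
      Ideal.Quotient.mkₐ k I (C (p.rep j) * (C (p.rep i)⁻¹ * X i)) := by
    intro j
    obtain ⟨s, t, hst⟩ := exists_combination
      (c := Pi.single j 1 + (-(p.rep j * (p.rep i)⁻¹)) • Pi.single i 1) p.rep_nonzero hpf hpg
      (by simp [add_dotProduct, hi']) hab
    have := congrArg linearForm hst
    simp only [linearForm_add, linearForm_smul, linearForm_single] at this
    refine Ideal.Quotient.eq.2 (Ideal.mem_span_pair.2 ⟨C s, C t, ?_⟩)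
    rw [← this]
    simp only [C_neg, C_mul]
    ring
  -- The quotient map factors through `restrictLine`, so a polynomial with zero restriction lies in
  -- `I`.
  have hcomp : Ideal.Quotient.mkₐ k I =
      (Polynomial.aeval (Ideal.Quotient.mkₐ k I (C (p.rep i)⁻¹ * X i))).comp
        (restrictLine p.rep) := by
    refine MvPolynomial.algHom_ext fun j => ?_
    rw [hX j, map_mul]
    simp [restrictLine, ← MvPolynomial.algebraMap_eq]
  have := DFunLike.congr_fun hcomp u
  rw [AlgHom.comp_apply, hu, map_zero] at this
  exact Ideal.Quotient.eq_zero_iff_mem.1 this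

/-- A polynomial vanishing at finitely many points of a line lies in the ideal generated by the
equation of the line and the product of equations of other lines, one through each point. -/
theorem exists_eq_of_forall_mem_zeros [Infinite k] {ι : Type*} (s : Finset ι) {p : ι → Plane k}
    (hp : Function.Injective p) {f : MvPolynomial (Fin 3) k} (hf : IsLineEq f)
    {h : ι → MvPolynomial (Fin 3) k} (hh : ∀ i, IsLineEq (h i)) (hpf : ∀ i, p i ∈ zeros f)
    (hph : ∀ i, p i ∈ zeros (h i)) (hne : ∀ i, zeros f ≠ zeros (h i))
    (u : MvPolynomial (Fin 3) k) (hu : ∀ i ∈ s, p i ∈ zeros u) :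
    ∃ a b, u = a * f + b * ∏ i ∈ s, h i := by
  classical
  induction s using Finset.induction_on generalizing u with
  | empty => exact ⟨0, u, by simp⟩
  | insert i s his ih =>
    obtain ⟨a, b, rfl⟩ := exists_eq_of_mem_zeros hf (hh i) (hne i) (hpf i) (hph i)
      (hu i (Finset.mem_insert_self i s))
    -- The line of `h i` meets that of `f` only at `p i`, so the cofactor `b` must vanish at the
    -- remaining points.
    obtain ⟨a', b', rfl⟩ := ih b fun j hj => by
      have h1 : p j ∈ zeros (b * h i) := by
        refine mem_zeros_of_add_left (g := a * f) ?_ (mem_zeros_mul.2 (Or.inr (hpf j)))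
        rw [add_comm]
        exact hu j (Finset.mem_insert_of_mem hj)
      refine (mem_zeros_mul.1 h1).resolve_right fun h2 => his ?_
      rwa [hp (eq_of_mem_zeros hf (hh i) (hne i) (hpf i) (hph i) (hpf j) h2)]
    refine ⟨a + a' * h i, b', ?_⟩
    rw [Finset.prod_insert his]
    ring

/-! ### Existence of lines and of join families -/

theorem exists_isLineEq_through (p q : Plane k) :
    ∃ f : MvPolynomial (Fin 3) k, IsLineEq f ∧ p ∈ zeros f ∧ q ∈ zeros f := by
  obtain ⟨a, ha, hp, hq⟩ := exists_orthogonal_pair p.rep q.rep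
  exact ⟨linearForm a, ⟨isHomogeneous_linearForm a, linearForm_ne_zero ha⟩,
    mem_zeros_linearForm.2 hp, mem_zeros_linearForm.2 hq⟩

theorem exists_not_mem_zeros [Infinite k] {f : MvPolynomial (Fin 3) k} (hf : IsLineEq f) :
    ∃ p, p ∉ zeros f := by
  by_contra! h
  apply hf.2
  refine MvPolynomial.funext fun v => ?_
  rw [map_zero]
  -- The origin represents no projective point.
  by_cases hv : v = 0
  · obtain ⟨a, rfl⟩ := exists_eq_linearForm hf.1
    rw [eval_linearForm, hv, dotProduct_zero]
  · exact h (Projectivization.mk k v hv) v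
      (by simp [Projectivization.submodule_mk, Submodule.mem_span_singleton_self])

theorem exists_isLineEq_ne [Infinite k] {f : MvPolynomial (Fin 3) k} (hf : IsLineEq f)
    (p : Plane k) :
    ∃ g : MvPolynomial (Fin 3) k, IsLineEq g ∧ p ∈ zeros g ∧ zeros g ≠ zeros f := by
  obtain ⟨w, hw⟩ := exists_not_mem_zeros hf
  obtain ⟨g, hg, hp, hwg⟩ := exists_isLineEq_through p w
  exact ⟨g, hg, hp, fun h => hw (h ▸ hwg)⟩

theorem exists_isJoinFamily [Infinite k] {ℓ₁ : MvPolynomial (Fin 3) k} (h₁ : IsLineEq ℓ₁)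
    {r₁ r₂ : ℕ} (hr : r₂ ≤ r₁) (p : Fin r₁ → Plane k) (q : Fin r₂ → Plane k) :
    ∃ h, IsJoinFamily ℓ₁ hr p q h := by
  have key : ∀ i : Fin r₁, ∃ f, IsLineEq f ∧ p i ∈ zeros f ∧
      (∀ hi : (i : ℕ) < r₂, q ⟨i, hi⟩ ∈ zeros f) ∧ (r₂ ≤ (i : ℕ) → zeros f ≠ zeros ℓ₁) := by
    intro i
    by_cases hi : (i : ℕ) < r₂
    · obtain ⟨f, hf, hp, hq⟩ := exists_isLineEq_through (p i) (q ⟨i, hi⟩)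
      exact ⟨f, hf, hp, fun _ => hq, fun h => absurd hi h.not_gt⟩
    · obtain ⟨f, hf, hp, hne⟩ := exists_isLineEq_ne h₁ (p i)
      exact ⟨f, hf, hp, fun h => absurd h hi, fun _ => hne⟩
  choose h hh hp hq hne using key
  exact ⟨h, hh, hp, fun i => hq (Fin.castLE hr i) i.2, hne⟩

/-! ### Points on two lines, off their intersection -/

/-- The ideal of finitely many points on two lines, none of them the intersection point. -/
theorem idealOf_eq_span [Infinite k] {A : Set (Plane k)} {ℓ₁ ℓ₂ : MvPolynomial (Fin 3) k}
    (h₁ : IsLineEq ℓ₁) (h₂ : IsLineEq ℓ₂) (hA : A ⊆ zeros ℓ₁ ∪ zeros ℓ₂)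
    (hx : ∀ x ∈ zeros ℓ₁ ∩ zeros ℓ₂, x ∉ A) {r₁ r₂ : ℕ} {hr : r₂ ≤ r₁}
    {p : Fin r₁ → Plane k} {q : Fin r₂ → Plane k} (hp : Function.Injective p)
    (hq : Function.Injective q) (hpA : Set.range p = A ∩ zeros ℓ₁)
    (hqA : Set.range q = A ∩ zeros ℓ₂) {h : Fin r₁ → MvPolynomial (Fin 3) k}
    (hh : IsJoinFamily ℓ₁ hr p q h) :
    idealOf A = Ideal.span {ℓ₁ * ℓ₂, ℓ₁ * ∏ i : Fin r₂, h (Fin.castLE hr i), ∏ i, h i} := by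
  have hp' : ∀ i, p i ∈ A ∩ zeros ℓ₁ := fun i => hpA ▸ Set.mem_range_self i
  have hq' : ∀ i, q i ∈ A ∩ zeros ℓ₂ := fun i => hqA ▸ Set.mem_range_self i
  have hq₁ : ∀ i, q i ∉ zeros ℓ₁ := fun i hi => hx _ ⟨hi, (hq' i).2⟩ (hq' i).1
  have hp₂ : ∀ i, p i ∉ zeros ℓ₂ := fun i hi => hx _ ⟨(hp' i).2, hi⟩ (hp' i).1
  apply le_antisymm
  · intro u hu
    rw [mem_idealOf] at hu
    obtain ⟨a, b, rfl⟩ := exists_eq_of_forall_mem_zeros Finset.univ hp h₁ hh.isLineEq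
      -- For i < r₂ the line of `h i` contains `q i`, which is off ℓ₁, so it differs from ℓ₁.
      (fun i => (hp' i).2) hh.mem_left (fun i heq => by
        by_cases hi : (i : ℕ) < r₂
        · exact hq₁ ⟨i, hi⟩ (heq ▸ hh.mem_right ⟨i, hi⟩)
        · exact hh.ne_line i (not_lt.1 hi) heq.symm) u fun i _ => hu (hp' i).1
    obtain ⟨c, d, rfl⟩ := exists_eq_of_forall_mem_zeros Finset.univ hq h₂
      (fun i => hh.isLineEq (Fin.castLE hr i)) (fun i => (hq' i).2) hh.mem_right
      (fun i heq => hp₂ (Fin.castLE hr i) (heq ▸ hh.mem_left _)) a fun i _ =>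
        (mem_zeros_mul.1 (mem_zeros_of_add_left (hu (hq' i).1) (mem_zeros_mul.2 (Or.inr
          (mem_zeros_prod.2 ⟨_, Finset.mem_univ _, hh.mem_right i⟩))))).resolve_right (hq₁ i)
    refine Submodule.mem_span_triple.2 ⟨c, d, b, ?_⟩
    simp only [smul_eq_mul]
    ring
  · rw [Ideal.span_le]
    rintro g (rfl | rfl | rfl) <;> refine mem_idealOf.2 fun x hxA => ?_
    · exact mem_zeros_mul.2 (hA hxA)
    · rcases hA hxA with hx₁ | hx₂
      · exact mem_zeros_mul.2 (Or.inl hx₁)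
      · obtain ⟨i, rfl⟩ : x ∈ Set.range q := hqA ▸ ⟨hxA, hx₂⟩
        exact mem_zeros_mul.2 (Or.inr
          (mem_zeros_prod.2 ⟨i, Finset.mem_univ _, hh.mem_right i⟩))
    · rcases hA hxA with hx₁ | hx₂
      · obtain ⟨i, rfl⟩ : x ∈ Set.range p := hpA ▸ ⟨hxA, hx₁⟩
        exact mem_zeros_prod.2 ⟨i, Finset.mem_univ _, hh.mem_left i⟩
      · obtain ⟨i, rfl⟩ : x ∈ Set.range q := hqA ▸ ⟨hxA, hx₂⟩
        exact mem_zeros_prod.2 ⟨_, Finset.mem_univ _, hh.mem_right i⟩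

/-! ### Generation by products of linear forms -/

theorem isProdLinear_of_isLineEq {f : MvPolynomial (Fin 3) k} (hf : IsLineEq f) :
    IsProdLinear f :=
  ⟨{f}, by simpa using hf.1, by simp⟩

theorem IsProdLinear.mul {f g : MvPolynomial (Fin 3) k} (hf : IsProdLinear f)
    (hg : IsProdLinear g) : IsProdLinear (f * g) := by
  obtain ⟨s, hs, rfl⟩ := hf
  obtain ⟨t, ht, rfl⟩ := hg
  refine ⟨s + t, fun f hf => ?_, (Multiset.prod_add s t).symm⟩
  exact (Multiset.mem_add.1 hf).elim (hs f) (ht f)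

theorem isProdLinear_prod {ι : Type*} (s : Finset ι) {h : ι → MvPolynomial (Fin 3) k}
    (hh : ∀ i, IsLineEq (h i)) : IsProdLinear (∏ i ∈ s, h i) := by
  refine ⟨s.val.map h, fun f hf => ?_, rfl⟩
  obtain ⟨i, _, rfl⟩ := Multiset.mem_map.1 hf
  exact (hh i).1

theorem isPLGenerated_of_subset_line [Infinite k] {A : Set (Plane k)} (hA : A.Finite)
    {ℓ : MvPolynomial (Fin 3) k} (hℓ : IsLineEq ℓ) (hAℓ : A ⊆ zeros ℓ) :
    IsPLGenerated (idealOf A) := by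
  have := hA.fintype
  choose h hh hph hne using fun x : A => exists_isLineEq_ne hℓ (x : Plane k)
  refine ⟨{ℓ, ∏ x, h x}, ?_, le_antisymm (fun u hu => ?_) (Ideal.span_le.2 ?_)⟩
  · rintro g (rfl | rfl)
    exacts [isProdLinear_of_isLineEq hℓ, isProdLinear_prod _ hh]
  · rw [mem_idealOf] at hu
    obtain ⟨a, b, rfl⟩ := exists_eq_of_forall_mem_zeros Finset.univ Subtype.val_injective hℓ hh
      (fun x => hAℓ x.2) hph (fun x => (hne x).symm) u fun x _ => hu x.2
    exact Ideal.mem_span_pair.2 ⟨a, b, rfl⟩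
  · rintro g (rfl | rfl)
    · exact mem_idealOf.2 hAℓ
    · exact mem_idealOf.2 fun x hx => mem_zeros_prod.2 ⟨⟨x, hx⟩, Finset.mem_univ _, hph _⟩

theorem isPLGenerated_of_mem_inter [Infinite k] {A : Set (Plane k)} (hA : A.Finite)
    {ℓ₁ ℓ₂ : MvPolynomial (Fin 3) k} (h₁ : IsLineEq ℓ₁) (h₂ : IsLineEq ℓ₂)
    (hne : zeros ℓ₁ ≠ zeros ℓ₂) (hAℓ : A ⊆ zeros ℓ₁ ∪ zeros ℓ₂) {x : Plane k} (hxA : x ∈ A)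
    (hx₁ : x ∈ zeros ℓ₁) (hx₂ : x ∈ zeros ℓ₂) : IsPLGenerated (idealOf A) := by
  have hx : ∀ y ∈ zeros ℓ₁, y ∈ zeros ℓ₂ → y = x := fun y hy₁ hy₂ =>
    eq_of_mem_zeros h₁ h₂ hne hy₁ hy₂ hx₁ hx₂
  have := (hA.inter_of_left (zeros ℓ₁ \ zeros ℓ₂)).fintype
  have := (hA.inter_of_left (zeros ℓ₂ \ zeros ℓ₁)).fintype
  choose g hg hpg hneg using
    fun y : ↑(A ∩ (zeros ℓ₁ \ zeros ℓ₂)) => exists_isLineEq_ne h₁ (y : Plane k)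
  choose h hh hph hneh using
    fun y : ↑(A ∩ (zeros ℓ₂ \ zeros ℓ₁)) => exists_isLineEq_ne h₂ (y : Plane k)
  refine ⟨{ℓ₁ * ℓ₂, ℓ₁ * ∏ y, h y, ℓ₂ * ∏ y, g y}, ?_,
    le_antisymm (fun u hu => ?_) (Ideal.span_le.2 ?_)⟩
  · have i₁ := isProdLinear_of_isLineEq h₁
    have i₂ := isProdLinear_of_isLineEq h₂
    rintro f (rfl | rfl | rfl)
    exacts [i₁.mul i₂, i₁.mul (isProdLinear_prod _ hh), i₂.mul (isProdLinear_prod _ hg)]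
  · rw [mem_idealOf] at hu
    obtain ⟨a, b, hab⟩ := exists_eq_of_forall_mem_zeros Finset.univ
      -- `none` stands for the intersection point `x`, with ℓ₂ as the line through it.
      (p := fun o : Option ↑(A ∩ (zeros ℓ₁ \ zeros ℓ₂)) => o.elim x Subtype.val)
      (h := fun o => o.elim ℓ₂ g)
      (Option.injective_iff.2 ⟨Subtype.val_injective, by
        rintro ⟨y, hy⟩
        exact y.2.2.2 ((show (y : Plane k) = x from hy) ▸ hx₂)⟩) h₁ (by rintro (_ | y); exacts [h₂, hg y])
      (by rintro (_ | y); exacts [hx₁, y.2.2.1]) (by rintro (_ | y); exacts [hx₂, hpg y])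
      (by rintro (_ | y); exacts [hne, (hneg y).symm]) u
      (by rintro (_ | y) _; exacts [hu hxA, hu y.2.1])
    simp only [Fintype.prod_option, Option.elim_none, Option.elim_some] at hab
    subst hab
    obtain ⟨c, d, rfl⟩ := exists_eq_of_forall_mem_zeros Finset.univ Subtype.val_injective h₂ hh
      (fun y => y.2.2.1) hph (fun y => (hneh y).symm) a fun y _ =>
        (mem_zeros_mul.1 (mem_zeros_of_add_left (hu y.2.1) (mem_zeros_mul.2 (Or.inr
          (mem_zeros_mul.2 (Or.inl y.2.2.1)))))).resolve_right y.2.2.2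
    refine Submodule.mem_span_triple.2 ⟨c, d, b, ?_⟩
    simp only [smul_eq_mul]
    ring
  · rintro f (rfl | rfl | rfl) <;> refine mem_idealOf.2 fun y hyA => mem_zeros_mul.2 ?_
    · exact hAℓ hyA
    · by_cases hy : y ∈ zeros ℓ₁
      · exact Or.inl hy
      · exact Or.inr (mem_zeros_prod.2
          ⟨⟨y, hyA, (hAℓ hyA).resolve_left hy, hy⟩, Finset.mem_univ _, hph _⟩)
    · by_cases hy : y ∈ zeros ℓ₂
      · exact Or.inl hy
      · exact Or.inr (mem_zeros_prod.2
          ⟨⟨y, hyA, (hAℓ hyA).resolve_right hy, hy⟩, Finset.mem_univ _, hpg _⟩)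

theorem exists_enumeration {A : Set (Plane k)} (hA : A.Finite) :
    ∃ p : Fin A.ncard → Plane k, Function.Injective p ∧ Set.range p = A := by
  have := hA.to_subtype
  let e : A ≃ Fin A.ncard := Finite.equivFin A
  refine ⟨fun i => e.symm i, Subtype.val_injective.comp e.symm.injective, ?_⟩
  rw [← Function.comp_def, e.symm.surjective.range_comp, Subtype.range_val]

theorem isPLGenerated_of_notMem_inter [Infinite k] {A : Set (Plane k)} (hA : A.Finite)
    {ℓ₁ ℓ₂ : MvPolynomial (Fin 3) k} (h₁ : IsLineEq ℓ₁) (h₂ : IsLineEq ℓ₂)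
    (hAℓ : A ⊆ zeros ℓ₁ ∪ zeros ℓ₂) (hx : ∀ x ∈ zeros ℓ₁ ∩ zeros ℓ₂, x ∉ A)
    (hr : (A ∩ zeros ℓ₂).ncard ≤ (A ∩ zeros ℓ₁).ncard) : IsPLGenerated (idealOf A) := by
  obtain ⟨p, hp, hpA⟩ := exists_enumeration (hA.inter_of_left (zeros ℓ₁))
  obtain ⟨q, hq, hqA⟩ := exists_enumeration (hA.inter_of_left (zeros ℓ₂))
  obtain ⟨h, hh⟩ := exists_isJoinFamily h₁ hr p q
  refine ⟨_, ?_, idealOf_eq_span h₁ h₂ hAℓ hx hp hq hpA hqA hh⟩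
  have i₁ := isProdLinear_of_isLineEq h₁
  rintro f (rfl | rfl | rfl)
  exacts [i₁.mul (isProdLinear_of_isLineEq h₂),
    i₁.mul (isProdLinear_prod _ fun i => hh.isLineEq _), isProdLinear_prod _ hh.isLineEq]

theorem isPLGenerated_of_subset_union [Infinite k] {A : Set (Plane k)} (hA : A.Finite)
    {ℓ₁ ℓ₂ : MvPolynomial (Fin 3) k} (h₁ : IsLineEq ℓ₁) (h₂ : IsLineEq ℓ₂)
    (hAℓ : A ⊆ zeros ℓ₁ ∪ zeros ℓ₂) : IsPLGenerated (idealOf A) := by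
  by_cases hne : zeros ℓ₁ = zeros ℓ₂
  -- The two lines may coincide here.
  · exact isPLGenerated_of_subset_line hA h₁ (by simpa [← hne] using hAℓ)
  by_cases hx : ∃ x ∈ zeros ℓ₁ ∩ zeros ℓ₂, x ∈ A
  · obtain ⟨x, ⟨hx₁, hx₂⟩, hxA⟩ := hx
    exact isPLGenerated_of_mem_inter hA h₁ h₂ hne hAℓ hxA hx₁ hx₂
  push Not at hx
  rcases le_total (A ∩ zeros ℓ₂).ncard (A ∩ zeros ℓ₁).ncard with hr | hr
  · exact isPLGenerated_of_notMem_inter hA h₁ h₂ hAℓ hx hr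
  · exact isPLGenerated_of_notMem_inter hA h₂ h₁ (Set.union_comm _ _ ▸ hAℓ)
      (Set.inter_comm _ _ ▸ hx) hr

end PLGen

theorem mainTheorem7 {k : Type*} [Field k] [Infinite k] (A : Set (PLGen.Plane k))
    (hA : A.Finite) :
    (∀ L₁ L₂ : Set (PLGen.Plane k), PLGen.IsLine L₁ → PLGen.IsLine L₂ → A ⊆ L₁ ∪ L₂ →
      PLGen.IsPLGenerated (PLGen.idealOf A)) ∧
    (∀ ℓ₁ ℓ₂ : MvPolynomial (Fin 3) k, PLGen.IsLineEq ℓ₁ → PLGen.IsLineEq ℓ₂ →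
      PLGen.zeros ℓ₁ ≠ PLGen.zeros ℓ₂ → A ⊆ PLGen.zeros ℓ₁ ∪ PLGen.zeros ℓ₂ →
      (∀ x ∈ PLGen.zeros ℓ₁ ∩ PLGen.zeros ℓ₂, x ∉ A) →
      ∀ (r₁ r₂ : ℕ) (hr : r₂ ≤ r₁) (p : Fin r₁ → PLGen.Plane k) (q : Fin r₂ → PLGen.Plane k),
        Function.Injective p → Function.Injective q →
        Set.range p = A ∩ PLGen.zeros ℓ₁ → Set.range q = A ∩ PLGen.zeros ℓ₂ →
        (∃ h : Fin r₁ → MvPolynomial (Fin 3) k, PLGen.IsJoinFamily ℓ₁ hr p q h) ∧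
        ∀ h : Fin r₁ → MvPolynomial (Fin 3) k, PLGen.IsJoinFamily ℓ₁ hr p q h →
          PLGen.idealOf A =
            Ideal.span {ℓ₁ * ℓ₂, ℓ₁ * ∏ i : Fin r₂, h (Fin.castLE hr i), ∏ i, h i} ∧
          (r₁ = r₂ → PLGen.idealOf A = Ideal.span {ℓ₁ * ℓ₂, ∏ i, h i})) := by
  refine ⟨?_, ?_⟩
  · rintro _ _ ⟨ℓ₁, h₁, rfl⟩ ⟨ℓ₂, h₂, rfl⟩ hAℓ
    exact PLGen.isPLGenerated_of_subset_union hA h₁ h₂ hAℓ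
  · intro ℓ₁ ℓ₂ h₁ h₂ _ hAℓ hx r₁ r₂ hr p q hp hq hpA hqA
    refine ⟨PLGen.exists_isJoinFamily h₁ hr p q, fun h hh => ?_⟩
    have key := PLGen.idealOf_eq_span h₁ h₂ hAℓ hx hp hq hpA hqA hh
    refine ⟨key, ?_⟩
    rintro rfl
    rw [key]
    simp only [Fin.castLE_rfl, id_eq]
    refine le_antisymm (Ideal.span_le.2 ?_) (Ideal.span_mono ?_)
    · rintro g (rfl | rfl | rfl)
      · exact Ideal.subset_span (by simp)
      -- For r₁ = r₂ the middle generator is ℓ₁ times the last one.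
      · exact Ideal.mul_mem_left _ _ (Ideal.subset_span (by simp))
      · exact Ideal.subset_span (by simp)
    · rintro g (rfl | rfl) <;> simp
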